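/- A directed graph $E=(E^0,E^1,r,s)$ consists of a set $E^0$ of vertices, a set $E^1$ of edges, and maps $r,s\colon E^1\to E^0$ giving the range and the source of each edge; it is row-finite if every vertex emits only finitely many edges, i.e. $s^{-1}(v)$ is finite for every $v\in E^0$. The graph monoid $M_E$ of a row-finite graph $E$ is the abelian monoid (written additively) given by the generators $\{a_v\mid v\in E^0\}$ and the relations $$a_v=\sum_{\{e\in E^1\mid s(e)=v\}}a_{r(e)}\qquad\text{for every } v\in E^0 \text{ that emits at least one edge}.$$ On any abelian monoid $M$, write $x\le y$ if $y=x+w$ for some $w\in M$. **Theorem 6.3 (separativity).** For every row-finite graph $E$, the graph monoid $M_E$ is separative: if $x,y,z\in M_E$ satisfy $x+z=y+z$, and if $z\le nx$ and $z\le ny$ for some positive integer $n$, then $x=y$. -/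

import Mathlib

universe u v

/-- A directed graph: a set `V` of vertices, a set `E` of edges, and the source and range maps.
Loops and multiple edges are allowed, and `V` and `E` are arbitrary (possibly infinite). -/
structure DirectedGraph (V : Type u) (E : Type v) where
  /-- the source of an edge -/
  source : E → V
  /-- the range of an edge -/
  range : E → V

namespace DirectedGraph

variable {V : Type u} {E : Type v}

/-- The set `s⁻¹(x)` of edges emitted by the vertex `x`. -/
def emitted (G : DirectedGraph V E) (x : V) : Set E :=
  {e | G.source e = x}

/-- A graph is row-finite if each vertex emits only finitely many edges. -/
def RowFinite (G : DirectedGraph V E) : Prop :=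
  ∀ x : V, (G.emitted x).Finite

/-- The element `r(x) = ∑_{s(e) = x} r(e)` of the free abelian monoid on the vertices,
which is realised as the monoid of finite multisets of vertices. -/
noncomputable def rangeSum (G : DirectedGraph V E) (hG : G.RowFinite) (x : V) : Multiset V :=
  ∑ e ∈ (hG x).toFinset, {G.range e}

/-- The defining relations `x = r(x)` of the graph monoid, one for each vertex `x` that emits
at least one edge. -/
inductive MonoidRel (G : DirectedGraph V E) (hG : G.RowFinite) : Multiset V → Multiset V → Prop
  | emits (x : V) (hx : (G.emitted x).Nonempty) : MonoidRel G hG {x} (G.rangeSum hG x)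

/-- The graph monoid: the abelian monoid with one generator for each vertex `x` and the relations
`x = r(x)` for the vertices `x` that emit edges, that is, the quotient of the free abelian monoid
on the vertices by the congruence generated by these relations. -/
abbrev GraphMonoid (G : DirectedGraph V E) (hG : G.RowFinite) : Type u :=
  (addConGen (G.MonoidRel hG)).Quotient

end DirectedGraph

/-- The algebraic pre-order of an abelian monoid: `x ≤ y` if `y = x + z` for some `z`. -/
def AlgLE {M : Type u} [AddCommMonoid M] (x y : M) : Prop :=
  ∃ z : M, y = x + z

/-- An abelian monoid is separative if `x + z = y + z`, together with `z ≤ n x` and `z ≤ n y` for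
some positive integer `n`, implies `x = y`; here `≤` is the algebraic pre-order. -/
def IsSeparative (M : Type u) [AddCommMonoid M] : Prop :=
  ∀ x y z : M, x + z = y + z →
    (∃ n : ℕ, 0 < n ∧ AlgLE z (n • x) ∧ AlgLE z (n • y)) → x = y

/-! Read a multiset of vertices as tokens, a firing replacing `x` by `r x`. Firing is confluent
(`Step.diamond`), so congruent multisets share a reduct (`join_of_con`), and reducts of a sum split
along it (`Red.split`). It suffices to cancel one vertex `v` at a time, with only finitely many
vertices allowed to fire. If `v` can fire and lies on no cycle, it is replaced by `r v`, whose
vertices reach fewer firing vertices. Otherwise `v` is recurrent: a common reduct of `x + v` and `y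
+ v` can be fired until the parts coming from the two copies of `v` become `v + e` and `v + e'`.
Cancelling `v` in the free monoid leaves reducts of `x` and `y` plus `e` and `e'`, which `x` and `y`
absorb because both dominate `v`. -/

namespace VertexFiring

open Relation

variable {V : Type u}

/-- Fire one vertex `x ∈ S` of a multiset of vertices, replacing it by `r x`. -/
def Step (r : V → Multiset V) (S : Set V) (a b : Multiset V) : Prop :=
  ∃ x ∈ S, ∃ c, a = {x} + c ∧ b = r x + c

/-- Fire finitely many vertices in succession. -/
abbrev Red (r : V → Multiset V) (S : Set V) : Multiset V → Multiset V → Prop :=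
  ReflTransGen (Step r S)

/-- The defining relations `x = r x` for `x ∈ S`. -/
def Rel (r : V → Multiset V) (S : Set V) (a b : Multiset V) : Prop :=
  ∃ x ∈ S, a = {x} ∧ b = r x

/-- The congruence generated by the relations `x = r x` for `x ∈ S`. -/
abbrev con (r : V → Multiset V) (S : Set V) : AddCon (Multiset V) :=
  addConGen (Rel r S)

variable {r : V → Multiset V} {S T : Set V}

theorem Step.add_right {a b : Multiset V} (h : Step r S a b) (d : Multiset V) :
    Step r S (a + d) (b + d) := by
  obtain ⟨x, hx, c, rfl, rfl⟩ := h
  exact ⟨x, hx, c + d, by rw [add_assoc], by rw [add_assoc]⟩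

theorem Red.add_right {a b : Multiset V} (h : Red r S a b) (d : Multiset V) :
    Red r S (a + d) (b + d) :=
  ReflTransGen.lift (· + d) (fun _ _ hs => Step.add_right hs d) _ _ h

theorem Red.add {a a' b b' : Multiset V} (h : Red r S a a') (h' : Red r S b b') :
    Red r S (a + b) (a' + b') := by
  refine (h.add_right b).trans ?_
  rw [add_comm a' b, add_comm a' b']
  exact h'.add_right a'

theorem Red.fire {x : V} (hx : x ∈ S) : Red r S {x} (r x) :=
  .single ⟨x, hx, 0, by simp, by simp⟩

/-! ### Splitting and confluence of firings -/

/-- A firing in a sum happens in one of the two summands. -/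
theorem Step.split {a b g : Multiset V} (h : Step r S (a + b) g) :
    (∃ a', Step r S a a' ∧ g = a' + b) ∨ ∃ b', Step r S b b' ∧ g = a + b' := by
  obtain ⟨x, hx, c, hc, rfl⟩ := h
  have hm : x ∈ a + b := by rw [hc]; simp
  rcases Multiset.mem_add.1 hm with hm | hm
  · obtain ⟨t, rfl⟩ := Multiset.exists_cons_of_mem hm
    left
    refine ⟨r x + t, ⟨x, hx, t, by simp, rfl⟩, ?_⟩
    have : c = t + b := by
      rw [← Multiset.singleton_add, add_assoc] at hc
      exact (add_left_cancel hc).symm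
    rw [this, add_assoc]
  · obtain ⟨t, rfl⟩ := Multiset.exists_cons_of_mem hm
    right
    refine ⟨r x + t, ⟨x, hx, t, by simp, rfl⟩, ?_⟩
    have : c = a + t := by
      rw [← Multiset.singleton_add, add_left_comm] at hc
      exact (add_left_cancel hc).symm
    rw [this, add_left_comm]

theorem Red.split {a b g : Multiset V} (h : Red r S (a + b) g) :
    ∃ a' b', Red r S a a' ∧ Red r S b b' ∧ g = a' + b' := by
  induction h with
  | refl => exact ⟨a, b, .refl, .refl, rfl⟩
  | tail _ hs ih =>
    obtain ⟨a', b', ha, hb, rfl⟩ := ih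
    rcases hs.split with ⟨a'', h, rfl⟩ | ⟨b'', h, rfl⟩
    · exact ⟨a'', b', ha.tail h, hb, rfl⟩
    · exact ⟨a', b'', ha, hb.tail h, rfl⟩

theorem Red.split_nsmul {a g : Multiset V} {n : ℕ} (h : Red r S (n • a) g) {c : V} (hc : c ∈ g) :
    ∃ a', Red r S a a' ∧ c ∈ a' := by
  induction n generalizing g with
  | zero =>
    rw [zero_nsmul] at h
    rcases h.cases_head with rfl | ⟨_, ⟨x, -, d, hd, -⟩, -⟩
    · simp at hc
    · simp at hd
  | succ n ih =>
    rw [succ_nsmul] at h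
    obtain ⟨p, q, hp, hq, rfl⟩ := h.split
    rcases Multiset.mem_add.1 hc with hc | hc
    · exact ih hp hc
    · exact ⟨q, hq, hc⟩

/-- Firings of distinct tokens commute, and two firings of one token agree because `r` is a
function. -/
theorem Step.diamond {a b c : Multiset V} (hb : Step r S a b) (hc : Step r S a c) :
    ∃ d, ReflGen (Step r S) b d ∧ Red r S c d := by
  obtain ⟨x, hx, p, rfl, rfl⟩ := hb
  rcases hc.split with ⟨a', ⟨y, hy, q, hq, rfl⟩, rfl⟩ | ⟨p', hp, rfl⟩
  · have hqx : ({x} : Multiset V) = y ::ₘ q := by rw [hq, Multiset.singleton_add]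
    obtain ⟨rfl, rfl⟩ : x = y ∧ q = 0 := by
      have hcard := congrArg Multiset.card hqx
      simp only [Multiset.card_singleton, Multiset.card_cons] at hcard
      have hq0 : q = 0 := Multiset.card_eq_zero.1 (by omega)
      subst hq0
      exact ⟨by simpa using hqx, rfl⟩
    exact ⟨r x + p, .refl, by rw [add_zero]⟩
  · refine ⟨r x + p', .single ?_, (Red.fire hx).add_right p'⟩
    rw [add_comm _ p, add_comm _ p']
    exact hp.add_right _

theorem equivalence_join_red : Equivalence (Join (Red r S)) :=
  equivalence_join_reflTransGen fun _ _ _ => Step.diamond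

theorem con_of_red {a b : Multiset V} (h : Red r S a b) : con r S a b := by
  induction h with
  | refl => exact (con r S).refl _
  | tail _ hs ih =>
    obtain ⟨x, hx, c, rfl, rfl⟩ := hs
    exact (con r S).trans ih <| (con r S).add
      (AddConGen.Rel.of _ _ ⟨x, hx, rfl, rfl⟩) ((con r S).refl _)

/-- Congruent multisets have a common reduct. -/
theorem join_of_con {a b : Multiset V} (h : con r S a b) : Join (Red r S) a b := by
  induction (h : AddConGen.Rel (Rel r S) a b) with
  | of a b h =>
    obtain ⟨x, hx, rfl, rfl⟩ := h
    exact ⟨_, Red.fire hx, .refl⟩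
  | refl => exact equivalence_join_red.refl _
  | symm h ih => exact equivalence_join_red.symm ih
  | trans h h' ih ih' => exact equivalence_join_red.trans ih ih'
  | add h h' ih ih' =>
    obtain ⟨g, h1, h2⟩ := ih
    obtain ⟨g', h1', h2'⟩ := ih'
    exact ⟨g + g', h1.add h1', h2.add h2'⟩

theorem con_mono (hST : S ⊆ T) {a b : Multiset V} (h : con r S a b) : con r T a b := by
  refine (AddCon.addConGen_mono (r := Rel r S) (s := Rel r T) ?_) h
  rintro _ _ ⟨x, hx, rfl, rfl⟩
  exact ⟨x, hST hx, rfl, rfl⟩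

/-- A congruence uses only finitely many of the defining relations. -/
theorem exists_finite_con {a b : Multiset V} (h : con r S a b) :
    ∃ T : Set V, T.Finite ∧ T ⊆ S ∧ con r T a b := by
  induction (h : AddConGen.Rel (Rel r S) a b) with
  | of a b h =>
    obtain ⟨x, hx, rfl, rfl⟩ := h
    exact ⟨{x}, Set.finite_singleton x, by simpa using hx,
      AddConGen.Rel.of _ _ ⟨x, rfl, rfl, rfl⟩⟩
  | refl => exact ⟨∅, Set.finite_empty, Set.empty_subset _, (con r ∅).refl _⟩
  | symm h ih =>
    obtain ⟨T, hT, hTS, hc⟩ := ih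
    exact ⟨T, hT, hTS, (con r T).symm hc⟩
  | trans h h' ih ih' =>
    obtain ⟨T, hT, hTS, hc⟩ := ih
    obtain ⟨T', hT', hTS', hc'⟩ := ih'
    exact ⟨T ∪ T', hT.union hT', Set.union_subset hTS hTS',
      (con r _).trans (con_mono Set.subset_union_left hc) (con_mono Set.subset_union_right hc')⟩
  | add h h' ih ih' =>
    obtain ⟨T, hT, hTS, hc⟩ := ih
    obtain ⟨T', hT', hTS', hc'⟩ := ih'
    exact ⟨T ∪ T', hT.union hT', Set.union_subset hTS hTS',
      (con r _).add (con_mono Set.subset_union_left hc) (con_mono Set.subset_union_right hc')⟩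

/-! ### Paths and recurrent vertices -/

/-- There is an edge from `x` to `y`, and `x` may fire. -/
def Edge (r : V → Multiset V) (S : Set V) (x y : V) : Prop :=
  x ∈ S ∧ y ∈ r x

theorem exists_red_of_path {c v : V} (h : ReflTransGen (Edge r S) c v) :
    ∃ e, Red r S {c} ({v} + e) := by
  induction h with
  | refl => exact ⟨0, by rw [add_zero]⟩
  | @tail b w _ hs ih =>
    obtain ⟨e, he⟩ := ih
    obtain ⟨t, ht⟩ := Multiset.exists_cons_of_mem hs.2
    refine ⟨t + e, he.trans ?_⟩
    have := (Red.fire (r := r) hs.1).add_right e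
    rwa [ht, ← Multiset.singleton_add, add_assoc] at this

/-- A vertex is recurrent if each of its reducts contains a vertex that leads back to it. -/
def Recurrent (r : V → Multiset V) (S : Set V) (v : V) : Prop :=
  ∀ g, Red r S {v} g → ∃ c ∈ g, ReflTransGen (Edge r S) c v

theorem recurrent_of_notMem {v : V} (hv : v ∉ S) : Recurrent r S v := by
  intro g hg
  rcases hg.cases_head with rfl | ⟨_, ⟨x, hx, d, hd, -⟩, -⟩
  · exact ⟨v, by simp, .refl⟩
  · have : x ∈ ({v} : Multiset V) := by rw [hd]; simp
    rw [Multiset.mem_singleton] at this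
    exact absurd (this ▸ hx) hv

theorem recurrent_of_cycle {v : V} (hv : TransGen (Edge r S) v v) : Recurrent r S v := by
  intro g hg
  induction hg with
  | refl => exact ⟨v, by simp, .refl⟩
  | tail _ hs ih =>
    obtain ⟨c, hc, hcv⟩ := ih
    obtain ⟨x, hx, d, rfl, rfl⟩ := hs
    rcases Multiset.mem_add.1 hc with hc | hc
    · obtain rfl := Multiset.mem_singleton.1 hc
      -- The path from `c` to `v` may be trivial; appending the cycle gives it a first edge, whose
      -- end lies in `r c`.
      obtain ⟨w, hw, hwv⟩ := TransGen.head'_iff.1 (TransGen.trans_right hcv hv)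
      exact ⟨w, Multiset.mem_add.2 (.inl hw.2), hwv⟩
    · exact ⟨c, Multiset.mem_add.2 (.inr hc), hcv⟩

/-- If a multiple of `x` dominates the recurrent vertex `v`, then so does `x`. -/
theorem Recurrent.exists_con_add {v : V} (hv : Recurrent r S v) {x d : Multiset V} {n : ℕ}
    (h : con r S (n • x) ({v} + d)) : ∃ e, con r S x ({v} + e) := by
  obtain ⟨g, hx, hg⟩ := join_of_con h
  obtain ⟨p, q, hp, -, rfl⟩ := hg.split
  -- The part `p` descending from `v` contains some `c` leading back to `v`. This `c` also occurs in
  -- a reduct of `n • x`, hence in a reduct of a single copy of `x`.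
  obtain ⟨c, hc, hcv⟩ := hv p hp
  obtain ⟨x', hx', hcx⟩ := hx.split_nsmul (Multiset.mem_add.2 (.inl hc))
  obtain ⟨t, rfl⟩ := Multiset.exists_cons_of_mem hcx
  obtain ⟨e, he⟩ := exists_red_of_path hcv
  refine ⟨e + t, con_of_red (hx'.trans ?_)⟩
  rw [← Multiset.singleton_add, ← add_assoc]
  exact he.add_right t

/-- All vertices leading to `v` can be fired simultaneously until each has produced `v`. -/
theorem exists_normalization (r : V → Multiset V) (S : Set V) (v : V) :
    ∃ f : Multiset V →+ Multiset V, (∀ a, Red r S a (f a)) ∧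
      ∀ c, ReflTransGen (Edge r S) c v → ∃ e, f {c} = {v} + e := by
  have key : ∀ c, ∃ b, Red r S {c} b ∧ (ReflTransGen (Edge r S) c v → ∃ e, b = {v} + e) := by
    intro c
    by_cases h : ReflTransGen (Edge r S) c v
    · obtain ⟨e, he⟩ := exists_red_of_path h
      exact ⟨_, he, fun _ => ⟨e, rfl⟩⟩
    · exact ⟨{c}, .refl, fun h' => absurd h' h⟩
  choose f hf hfv using key
  refine ⟨⟨⟨fun a => a.bind f, Multiset.zero_bind f⟩, fun a b => Multiset.add_bind a b f⟩,
    fun a => ?_, fun c hc => ?_⟩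
  · induction a using Multiset.induction with
    | empty => exact .refl
    | cons c a ih =>
      change Red r S _ (Multiset.bind _ f)
      rw [Multiset.cons_bind, ← Multiset.singleton_add]
      exact (hf c).add ih
  · obtain ⟨e, he⟩ := hfv c hc
    exact ⟨e, (Multiset.singleton_bind c f).trans he⟩

/-! ### Cancellation -/

/-- `z` may be cancelled from sums with elements that have multiples dominating `z`. -/
def Cancellable (r : V → Multiset V) (S : Set V) (z : Multiset V) : Prop :=
  ∀ (x y d d' : Multiset V) (n : ℕ), con r S (x + z) (y + z) →
    con r S (n • x) (z + d) → con r S (n • y) (z + d') → con r S x y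

theorem Recurrent.cancellable {v : V} (hv : Recurrent r S v) : Cancellable r S {v} := by
  intro x y d d' n h hx hy
  obtain ⟨a, ha⟩ := hv.exists_con_add hx
  obtain ⟨b, hb⟩ := hv.exists_con_add hy
  obtain ⟨g, h1, h2⟩ := join_of_con h
  obtain ⟨f, hf, hfv⟩ := exists_normalization r S v
  have key : ∀ z z' : Multiset V, Red r S {v} z' → con r S z ({v} + a) ∨ con r S z ({v} + b) →
      ∃ e, f z' = {v} + e ∧ con r S (z + e) z := by
    intro z z' hz' hz
    obtain ⟨c, hc, hcv⟩ := hv z' hz'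
    obtain ⟨t, rfl⟩ := Multiset.exists_cons_of_mem hc
    obtain ⟨e, he⟩ := hfv c hcv
    have hfe : f (c ::ₘ t) = {v} + (e + f t) := by
      rw [← Multiset.singleton_add, map_add, he, add_assoc]
    refine ⟨e + f t, hfe, ?_⟩
    -- Since `v` is congruent to `v` plus this remainder, anything congruent to `v + w` absorbs the
    -- remainder.
    have hve : con r S {v} ({v} + (e + f t)) := con_of_red (hfe ▸ hz'.trans (hf _))
    have absorb : ∀ w, con r S z ({v} + w) → con r S (z + (e + f t)) z := by
      intro w hw
      have h3 := (con r S).add hw ((con r S).refl (e + f t))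
      have h4 := (con r S).add ((con r S).symm hve) ((con r S).refl w)
      rw [add_right_comm] at h3
      exact (con r S).trans h3 ((con r S).trans h4 ((con r S).symm hw))
    exact hz.elim (absorb a) (absorb b)
  obtain ⟨x', p, hxx, hp, rfl⟩ := h1.split
  obtain ⟨y', q, hyy, hq, hpq⟩ := h2.split
  obtain ⟨e, hpe, he⟩ := key x p hp (.inl ha)
  obtain ⟨e', hqe, he'⟩ := key y q hq (.inr hb)
  -- Additivity of `f` makes it respect both decompositions of the common reduct, so `v` cancels as
  -- an equality of multisets.
  have heq : f x' + e = f y' + e' := by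
    have := congrArg f hpq
    rw [map_add, map_add, hpe, hqe, add_left_comm, add_left_comm (f y')] at this
    exact add_left_cancel this
  have hx' := (con r S).add (con_of_red (hxx.trans (hf x'))) ((con r S).refl e)
  have hy' := (con r S).add (con_of_red (hyy.trans (hf y'))) ((con r S).refl e')
  rw [heq] at hx'
  exact (con r S).trans ((con r S).symm he) <| (con r S).trans hx' <|
    (con r S).trans ((con r S).symm hy') he'

theorem cancellable_of_forall_mem {z : Multiset V} (h : ∀ w ∈ z, Cancellable r S {w}) :
    Cancellable r S z := by
  induction z using Multiset.induction with
  | empty =>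
    intro x y d d' n hxy _ _
    simpa using hxy
  | cons w z ih =>
    intro x y d d' n hxy hx hy
    rw [← Multiset.singleton_add] at hxy hx hy
    -- Adding `z` to `x` and `y` keeps their multiples above `w`, so `w` can be cancelled before
    -- `z`.
    have shift : ∀ {u e : Multiset V}, con r S (n • u) ({w} + z + e) →
        con r S (n • (u + z)) ({w} + (z + e + n • z)) := by
      intro u e hu
      have := (con r S).add hu ((con r S).refl (n • z))
      simpa only [nsmul_add, add_assoc] using this
    have hxy' : con r S (x + z + {w}) (y + z + {w}) := by
      rwa [add_assoc, add_comm z, add_assoc, add_comm z]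
    have hxz := h w (Multiset.mem_cons_self w z) _ _ _ _ n hxy' (shift hx) (shift hy)
    refine ih (fun u hu => h u (Multiset.mem_cons_of_mem hu)) x y ({w} + d) ({w} + d') n hxz ?_ ?_
    · rwa [← add_assoc, add_comm z]
    · rwa [← add_assoc, add_comm z]

theorem cancellable_of_fire {v : V} (hv : v ∈ S) (h : Cancellable r S (r v)) :
    Cancellable r S {v} := by
  intro x y d d' n hxy hx hy
  have hr : con r S {v} (r v) := con_of_red (Red.fire hv)
  have hd : ∀ w, con r S ({v} + w) (r v + w) := fun w => (con r S).add hr ((con r S).refl w)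
  have hw : ∀ w, con r S (w + {v}) (w + r v) := fun w => (con r S).add ((con r S).refl w) hr
  exact h x y d d' n ((con r S).trans ((con r S).symm (hw x)) ((con r S).trans hxy (hw y)))
    ((con r S).trans hx (hd d)) ((con r S).trans hy (hd d'))

/-- Induction on the number of firing vertices reachable from `v`. Off cycles, it drops along each
edge `v → w`, since `w` cannot reach `v`; finiteness of `S` makes the drop strict. -/
theorem cancellable_singleton (hS : S.Finite) (v : V) : Cancellable r S {v} := by
  induction hn : (S ∩ {w | ReflTransGen (Edge r S) v w}).ncard using Nat.strong_induction_on
    generalizing v with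
  | _ n ih =>
    by_cases hv : v ∈ S
    · by_cases hc : TransGen (Edge r S) v v
      · exact (recurrent_of_cycle hc).cancellable
      · refine cancellable_of_fire hv (cancellable_of_forall_mem fun w hw => ih _ ?_ w rfl)
        have hvw : Edge r S v w := ⟨hv, hw⟩
        rw [← hn]
        refine Set.ncard_lt_ncard ⟨fun u hu => ⟨hu.1, hu.2.head hvw⟩, fun hsub => ?_⟩
          (hS.inter_of_left _)
        exact hc (TransGen.head' hvw (hsub ⟨hv, .refl⟩).2)
    · exact (recurrent_of_notMem hv).cancellable

/-- The three given congruences use finitely many relations in total, which reduces to finite `S`.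
-/
theorem cancellable (z : Multiset V) : Cancellable r S z := by
  intro x y d d' n hxy hx hy
  obtain ⟨T₁, hT₁, hS₁, h₁⟩ := exists_finite_con hxy
  obtain ⟨T₂, hT₂, hS₂, h₂⟩ := exists_finite_con hx
  obtain ⟨T₃, hT₃, hS₃, h₃⟩ := exists_finite_con hy
  have hT : (T₁ ∪ T₂ ∪ T₃).Finite := (hT₁.union hT₂).union hT₃
  have hTS : T₁ ∪ T₂ ∪ T₃ ⊆ S := Set.union_subset (Set.union_subset hS₁ hS₂) hS₃
  refine con_mono hTS ?_
  exact cancellable_of_forall_mem (fun w _ => cancellable_singleton hT w) x y d d' n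
    (con_mono (fun _ h => .inl (.inl h)) h₁) (con_mono (fun _ h => .inl (.inr h)) h₂)
    (con_mono (fun _ h => .inr h) h₃)

end VertexFiring

theorem DirectedGraph.monoidRel_eq_rel {V : Type u} {E : Type v} (G : DirectedGraph V E)
    (hG : G.RowFinite) :
    G.MonoidRel hG = VertexFiring.Rel (G.rangeSum hG) {x | (G.emitted x).Nonempty} := by
  ext a b
  constructor
  · rintro ⟨x, hx⟩
    exact ⟨x, hx, rfl, rfl⟩
  · rintro ⟨x, hx, rfl, rfl⟩
    exact .emits x hx

theorem theorem6p3 {V : Type u} {E : Type v} (G : DirectedGraph V E) (hG : G.RowFinite) :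
    IsSeparative (G.GraphMonoid hG) := by
  unfold DirectedGraph.GraphMonoid
  rw [G.monoidRel_eq_rel hG]
  intro x y z hxy ⟨n, _, ⟨d, hx⟩, ⟨d', hy⟩⟩
  induction x using AddCon.induction_on with | _ x
  induction y using AddCon.induction_on with | _ y
  induction z using AddCon.induction_on with | _ z
  induction d using AddCon.induction_on with | _ d
  induction d' using AddCon.induction_on with | _ d'
  exact (AddCon.eq _).2 (VertexFiring.cancellable z x y d d' n ((AddCon.eq _).1 hxy)
    ((AddCon.eq _).1 hx) ((AddCon.eq _).1 hy))
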